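/- Let $p$ be a prime and let $(R,\mathfrak m,k)$ be a (commutative Noetherian) Cohen–Macaulay local ring of characteristic $p$ and of Krull dimension $d$. An $R$-module is called maximal Cohen–Macaulay (MCM) if it is nonzero, finitely generated and of depth $d$. Let $\omega$ be a canonical module of $R$, that is, an MCM $R$-module of finite injective dimension with $\dim_k \operatorname{Ext}^d_R(k,\omega)=1$, and assume that $\omega$ has a rank, that is, $\omega\otimes_R Q$ is a free $Q$-module, where $Q$ is the total ring of fractions of $R$. For $n\ge 0$ let $F^n(\omega)=\omega\otimes_R {}^{f^n}\!R$ be the base change of $\omega$ along the $n$-th iterate $f^n\colon R\to R$, $r\mapsto r^{p^n}$, of the Frobenius endomorphism, regarded as an $R$-module through the target of $f^n$. Put $$\kappa(R)=\inf\{t\ge 0 : \text{there is a system of parameters } x_1,\dots,x_d \text{ of } R \text{ with } \mathfrak m^{[p^t]}\subseteq (x_1,\dots,x_d)\},$$ where $\mathfrak m^{[p^t]}$ is the ideal generated by the $p^t$-th powers of the elements of $\mathfrak m$. If $F^n(\omega)$ is MCM for one $n\ge\kappa(R)$, then $R$ is Gorenstein, that is, $R$ has finite injective dimension as a module over itself.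 -/

import Mathlib

universe u

namespace FrobeniusGorenstein

open IsLocalRing CategoryTheory

noncomputable section

/-- The depth of a module `M` over a local ring `R`: the supremum of the lengths of the
`M`-regular sequences contained in the maximal ideal. -/
def depth (R : Type u) [CommRing R] [IsLocalRing R] (M : Type u) [AddCommGroup M]
    [Module R M] : ℕ∞ :=
  ⨆ rs ∈ {rs : List R | (∀ r ∈ rs, r ∈ maximalIdeal R) ∧ RingTheory.Sequence.IsRegular M rs},
    (rs.length : ℕ∞)

/-- A maximal Cohen-Macaulay module over a local ring `R`: a nonzero finitely generated module
whose depth is the Krull dimension of `R`. -/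
structure IsMaximalCohenMacaulay (R : Type u) [CommRing R] [IsLocalRing R] (M : Type u)
    [AddCommGroup M] [Module R M] : Prop where
  finite : Module.Finite R M
  nontrivial : Nontrivial M
  depth_eq : (depth R M : WithBot ℕ∞) = ringKrullDim R

/-- A local ring is Cohen-Macaulay if it is Noetherian and its depth, as a module over itself, is
its Krull dimension. -/
structure IsCohenMacaulayLocalRing (R : Type u) [CommRing R] [IsLocalRing R] : Prop where
  noetherian : IsNoetherianRing R
  depth_eq : (depth R R : WithBot ℕ∞) = ringKrullDim R

/-- `M` has finite injective dimension over `R`. -/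
def HasFiniteInjectiveDimension (R : Type u) [CommRing R] (M : Type u) [AddCommGroup M]
    [Module R M] : Prop :=
  ∃ n : ℕ, HasInjectiveDimensionLE (ModuleCat.of R M) n

/-- A local ring is Gorenstein if it is Noetherian and has finite injective dimension as a module
over itself. -/
structure IsGorensteinLocalRing (R : Type u) [CommRing R] [IsLocalRing R] : Prop where
  noetherian : IsNoetherianRing R
  finite_injectiveDimension : HasFiniteInjectiveDimension R R

/-- A canonical module of a (Cohen-Macaulay) local ring `R` with residue field `k`: a maximal
Cohen-Macaulay module of finite injective dimension and of type `1`. The latter means that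
`Ext^d_R(k, ω)`, `d = depth ω = dim R`, is one-dimensional over `k`; since the `R`-module
structure of this `Ext` is induced from that of `k`, this says that it is isomorphic to `k`. -/
structure IsCanonicalModule (R : Type u) [CommRing R] [IsLocalRing R] (ω : Type u)
    [AddCommGroup ω] [Module R ω] : Prop where
  maximalCohenMacaulay : IsMaximalCohenMacaulay R ω
  finite_injectiveDimension : HasFiniteInjectiveDimension R ω
  type_one : ∃ d : ℕ, (d : WithBot ℕ∞) = ringKrullDim R ∧
    Nonempty (Abelian.Ext (ModuleCat.of R (ResidueField R)) (ModuleCat.of R ω) d ≃ₗ[R]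
      ResidueField R)

/-- `M` has a rank: for some `r`, the localization of `M` at the set of all nonzerodivisors of
`R` is free of rank `r` over the total ring of fractions of `R`. -/
def HasRank (R : Type u) [CommRing R] (M : Type u) [AddCommGroup M] [Module R M] : Prop :=
  ∃ r : ℕ, Nonempty (LocalizedModule (nonZeroDivisors R) M ≃ₗ[Localization (nonZeroDivisors R)]
    (Fin r → Localization (nonZeroDivisors R)))

/-- The Frobenius functor of Peskine and Szpiro: base change along the `n`-th iterate
`r ↦ r ^ (p ^ n)` of the Frobenius endomorphism of `R`, with the `R`-module structure coming from
the target of the base change map. -/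
abbrev frobeniusFunctor (R : Type u) [CommRing R] (p : ℕ) [Fact p.Prime] [CharP R p] (n : ℕ) :
    ModuleCat.{u} R ⥤ ModuleCat.{u} R :=
  ModuleCat.extendScalars (iterateFrobenius R p n)

/-- The Frobenius power `I^[p^n]`: the ideal generated by the `p^n`-th powers of the elements
(equivalently, of a set of generators) of `I`. -/
def frobeniusPower {R : Type u} [CommRing R] (p n : ℕ) (I : Ideal R) : Ideal R :=
  Ideal.span ((fun r : R => r ^ p ^ n) '' (I : Set R))

/-- `x₁, …, x_d` is a (full) system of parameters of the Noetherian local ring `R`: `d = dim R`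
and the ideal generated by `x₁, …, x_d` is primary to the maximal ideal. -/
def IsSystemOfParameters (R : Type u) [CommRing R] [IsLocalRing R] {d : ℕ} (x : Fin d → R) :
    Prop :=
  (d : WithBot ℕ∞) = ringKrullDim R ∧ (Ideal.span (Set.range x)).radical = maximalIdeal R

/-- `κ(R)`: the infimum of all `t` such that `𝔪^[p^t] ⊆ (x)` for some system of parameters `x`
of `R`. -/
def kappa (R : Type u) [CommRing R] [IsLocalRing R] (p : ℕ) : ℕ∞ :=
  ⨅ t ∈ {t : ℕ | ∃ (d : ℕ) (x : Fin d → R), IsSystemOfParameters R x ∧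
    frobeniusPower p t (maximalIdeal R) ≤ Ideal.span (Set.range x)}, (t : ℕ∞)

end

end FrobeniusGorenstein

/-! Choose minimal generators `v` of ω, so that all relations have coefficients in 𝔪. Over F^n(ω)
the relations come from those of ω by raising coefficients to the power p^n, so the kernel K of R^r
→ F^n(ω) lies in (x)R^r for a parameter ideal (x) ⊇ 𝔪^[p^n]. As F^n(ω) is MCM, x is regular on it,
so K/(x)K embeds in R^r/(x)R^r; its image there is zero, and Nakayama gives K = 0
(`ker_eq_bot_of_ker_le_ofList_smul`). Hence every coefficient of a relation of ω is nilpotent. Over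
Q the module ω is free, so Q^r → ω ⊗ Q splits. Its kernel lies in nil(Q)·Q^r, hence is zero by
Nakayama once more, and ω is free over R (`linearIndependent_of_isNilpotent`). Then R is a direct
summand of ω and inherits finite injective dimension. -/

namespace FrobeniusGorenstein

open IsLocalRing CategoryTheory RingTheory.Sequence Abelian Limits
open scoped Pointwise TensorProduct ChangeOfRings

variable {R : Type u} [CommRing R]

/-! ### Systems of parameters are regular sequences on MCM modules. -/

/-- A prime strictly containing `p` by an element `x ∉ p` has quotient of smaller dimension. -/
lemma ringKrullDim_quotient_add_one_le_of_notMem {p q : Ideal R} [p.IsPrime] (hpq : p ≤ q) {x : R}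
    (hxp : x ∉ p) (hxq : x ∈ q) : ringKrullDim (R ⧸ q) + 1 ≤ ringKrullDim (R ⧸ p) := by
  have hx : Ideal.Quotient.mk p x ∈ nonZeroDivisors (R ⧸ p) := by
    rw [mem_nonZeroDivisors_iff_ne_zero, Ne, Ideal.Quotient.eq_zero_iff_mem]
    exact hxp
  refine le_trans ?_ (ringKrullDim_quotient_succ_le_of_nonZeroDivisor hx)
  gcongr
  let g : (R ⧸ p) ⧸ Ideal.span {Ideal.Quotient.mk p x} →+* R ⧸ q :=
    Ideal.Quotient.lift _ (Ideal.Quotient.factor hpq) fun a ha ↦ by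
      have : Ideal.span {Ideal.Quotient.mk p x} ≤ RingHom.ker (Ideal.Quotient.factor hpq) := by
        rw [Ideal.span_singleton_le_iff_mem, RingHom.mem_ker, Ideal.Quotient.factor_mk,
          Ideal.Quotient.eq_zero_iff_mem]
        exact hxq
      exact this ha
  exact ringKrullDim_le_of_surjective g
    (Ideal.Quotient.lift_surjective_of_surjective _ _ (Ideal.Quotient.factor_surjective hpq))

section IsLocalRing

variable [IsLocalRing R]

/-- An associated prime of `M` is strictly contained in an associated prime of `M / x M`, if `x` is
an `M`-regular element of the maximal ideal. -/
lemma exists_isAssociatedPrime_quotSMulTop [IsNoetherianRing R] {M : Type*} [AddCommGroup M]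
    [Module R M] [Module.Finite R M] {x : R} (hxm : x ∈ maximalIdeal R) (hx : IsSMulRegular M x)
    {p : Ideal R} (hp : IsAssociatedPrime p M) :
    x ∉ p ∧ ∃ q : Ideal R, IsAssociatedPrime q (QuotSMulTop x M) ∧ p ≤ q ∧ x ∈ q := by
  obtain ⟨hprime, z, hz⟩ := isAssociatedPrime_iff.mp hp
  have hmem (r : R) : r ∈ p ↔ r • z = 0 := by
    rw [hz, Submodule.mem_colon_singleton, Submodule.mem_bot]
  have hz0 : z ≠ 0 := by
    rintro rfl
    exact hprime.ne_top ((Ideal.eq_top_iff_one _).mpr ((hmem 1).mpr (smul_zero _)))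
  refine ⟨fun h ↦ hz0 (hx.right_eq_zero_of_smul ((hmem x).mp h)), ?_⟩
  -- `T` consists of the elements killed by `p`. If `T ⊆ xM`, regularity of `x` gives `T = xT`, so
  -- `T = 0` by Nakayama. Otherwise some `y ∈ T` has a nonzero class in `M/xM` killed by both `p`
  -- and `x`.
  let T : Submodule R M := Submodule.torsionBySet R M p
  have hzT : z ∈ T := by
    rw [Submodule.mem_torsionBySet_iff]
    exact fun a ↦ (hmem a).mp a.2
  have hT : ¬ T ≤ x • (⊤ : Submodule R M) := by
    intro h
    have : T ≤ maximalIdeal R • T := by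
      intro y hy
      obtain ⟨w, -, rfl⟩ := (Submodule.mem_smul_pointwise_iff_exists _ _ _).mp (h hy)
      refine Submodule.smul_mem_smul hxm ?_
      rw [Submodule.mem_torsionBySet_iff] at hy ⊢
      intro a
      apply hx.right_eq_zero_of_smul
      rw [smul_comm]
      exact hy a
    have := Submodule.eq_bot_of_le_smul_of_le_jacobson_bot _ T (IsNoetherian.noetherian T) this
      (maximalIdeal_le_jacobson _)
    rw [this, Submodule.mem_bot] at hzT
    exact hz0 hzT
  obtain ⟨y, hyT, hy⟩ := SetLike.not_le_iff_exists.mp hT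
  obtain ⟨q, hq, hle⟩ := exists_le_isAssociatedPrime_of_isNoetherianRing R
    (Submodule.Quotient.mk y : QuotSMulTop x M)
    (by rwa [Ne, Submodule.Quotient.mk_eq_zero])
  have hmemq {r : R} (h : r • y ∈ x • (⊤ : Submodule R M)) : r ∈ q := by
    apply hle
    rw [Submodule.mem_colon_singleton, Submodule.mem_bot, ← Submodule.Quotient.mk_smul,
      Submodule.Quotient.mk_eq_zero]
    exact h
  refine ⟨q, hq, fun r hr ↦ hmemq ?_, hmemq (Submodule.smul_mem_pointwise_smul _ _ _ trivial)⟩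
  rw [(Submodule.mem_torsionBySet_iff _ _).mp hyT ⟨r, hr⟩]
  exact Submodule.zero_mem _

/-- The length of a regular sequence is at most `dim R / p` for all associated primes `p`. -/
lemma length_le_ringKrullDim_quotient [IsNoetherianRing R] (rs : List R) :
    ∀ {M : Type u} [AddCommGroup M] [Module R M] [Module.Finite R M],
    (∀ r ∈ rs, r ∈ maximalIdeal R) → IsWeaklyRegular M rs → ∀ {p : Ideal R},
    IsAssociatedPrime p M → (rs.length : WithBot ℕ∞) ≤ ringKrullDim (R ⧸ p) := by
  induction rs with
  | nil =>
    intro M _ _ _ _ _ p hp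
    have := hp.isPrime
    exact ringKrullDim_nonneg_of_nontrivial
  | cons x rs ih =>
    intro M _ _ _ hmem hreg p hp
    rw [isWeaklyRegular_cons_iff] at hreg
    simp only [List.mem_cons, forall_eq_or_imp] at hmem
    have := hp.isPrime
    obtain ⟨hxp, q, hq, hpq, hxq⟩ := exists_isAssociatedPrime_quotSMulTop hmem.1 hreg.1 hp
    rw [List.length_cons, Nat.cast_succ]
    exact (add_le_add_left (ih hmem.2 hreg.2 hq) 1).trans
      (ringKrullDim_quotient_add_one_le_of_notMem hpq hxp hxq)

/-- Modulo a regular element of the maximal ideal, the maximal length of a regular sequence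
decreases by at most one. -/
lemma exists_isRegular_quotSMulTop [IsNoetherianRing R] {M : Type u} [AddCommGroup M] [Module R M]
    [Module.Finite R M] [Nontrivial M] {n : ℕ}
    (h : ∃ rs : List R, rs.length = n + 1 ∧ (∀ r ∈ rs, r ∈ maximalIdeal R) ∧ IsRegular M rs)
    {x : R} (hxm : x ∈ maximalIdeal R) (hx : IsSMulRegular M x) :
    ∃ rs : List R, rs.length = n ∧ (∀ r ∈ rs, r ∈ maximalIdeal R) ∧
      IsRegular (QuotSMulTop x M) rs := by
  have smul_lt (L : Type u) [AddCommGroup L] [Module R L] [Module.Finite R L] [Nontrivial L] :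
      maximalIdeal R • (⊤ : Submodule R (ModuleCat.of R L)) < ⊤ :=
    (Submodule.top_ne_ideal_smul_of_le_jacobson_annihilator
      (maximalIdeal_le_jacobson _)).symm.lt_top
  have := nontrivial_quotSMulTop_of_mem_maximalIdeal M hxm
  have tfae (i : ℕ) (L : Type u) [AddCommGroup L] [Module R L] [Module.Finite R L] [Nontrivial L] :=
    (ModuleCat.exists_isRegular_tfae (maximalIdeal R) i (ModuleCat.of R L) (smul_lt L)).out 1 3
  -- Regular sequences are traded for vanishing of Ext out of R/𝔪 in low degrees; Ext^i into `M/xM`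
  -- sits between Ext^i and Ext^(i+1) into `M`.
  have hM := (tfae (n + 1) M).mpr h
  refine (tfae n (QuotSMulTop x M)).mp fun i hi ↦ ?_
  have zero1 := AddCommGrpCat.isZero_of_iff_subsingleton.mpr (hM i (by omega))
  have zero2 := AddCommGrpCat.isZero_of_iff_subsingleton.mpr (hM (i + 1) (by omega))
  have hx' : IsSMulRegular (ModuleCat.of R M) x := hx
  exact AddCommGrpCat.subsingleton_of_isZero <| ShortComplex.Exact.isZero_of_both_zeros
    ((Ext.covariant_sequence_exact₃' _ hx'.smulShortComplex_shortExact) i (i + 1) rfl)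
    (zero1.eq_zero_of_src _) (zero2.eq_zero_of_tgt _)

/-- If the maximal ideal is the radical of an ideal generated by `p` and the elements of a list,
then `dim R / p` is at most the length of the list. -/
lemma ringKrullDim_quotient_le_length [IsNoetherianRing R] {p : Ideal R} [p.IsPrime] {xs : List R}
    (hrad : maximalIdeal R ≤ (p ⊔ Ideal.ofList xs).radical) (hmem : ∀ r ∈ xs, r ∈ maximalIdeal R) :
    ringKrullDim (R ⧸ p) ≤ xs.length := by
  classical
  let π := Ideal.Quotient.mk p
  have hπ : Function.Surjective π := Ideal.Quotient.mk_surjective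
  have : IsLocalRing (R ⧸ p) := IsLocalRing.of_surjective' π hπ
  have hcomap : (maximalIdeal (R ⧸ p)).comap π = maximalIdeal R :=
    IsLocalRing.eq_maximalIdeal (Ideal.comap_isMaximal_of_surjective π hπ)
  have hspan : Ideal.span ((xs.toFinset.image π : Finset (R ⧸ p)) : Set (R ⧸ p)) =
      (Ideal.ofList xs).map π := by
    rw [Ideal.ofList, Ideal.map_span]
    simp
  -- This puts the claim within reach of Krull's height theorem in `R ⧸ p`.
  have hmin : maximalIdeal (R ⧸ p) ∈
      (Ideal.span ((xs.toFinset.image π : Finset (R ⧸ p)) : Set (R ⧸ p))).minimalPrimes := by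
    rw [hspan]
    refine ⟨⟨inferInstance, ?_⟩, fun Q ⟨hQ, hle⟩ _ ↦ ?_⟩
    · rw [Ideal.map_le_iff_le_comap, hcomap]
      exact Ideal.span_le.mpr hmem
    · rw [← Ideal.comap_le_comap_iff_of_surjective π hπ,
        hcomap]
      refine hrad.trans ((Ideal.IsPrime.radical_le_iff inferInstance).mpr (sup_le ?_ ?_))
      · intro a ha
        rw [Ideal.mem_comap, show π a = 0 from Ideal.Quotient.eq_zero_iff_mem.mpr ha]
        exact Q.zero_mem
      · exact Ideal.map_le_iff_le_comap.mp hle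
  rw [← IsLocalRing.maximalIdeal_height_eq_ringKrullDim]
  have h := (Ideal.height_le_card_of_mem_minimalPrimes_span_finset hmin).trans
    (Nat.cast_le.mpr (Finset.card_image_le.trans xs.toFinset_card_le))
  exact_mod_cast h

/-- A sequence `xs` in the maximal ideal is regular on a finite module `M` with `J M = 0` as soon as
`J + (xs)` is primary to the maximal ideal and there is some regular sequence of the same length. -/
lemma isRegular_of_maximalIdeal_le_radical [IsNoetherianRing R] (xs : List R) :
    ∀ {M : Type u} [AddCommGroup M] [Module R M] [Module.Finite R M] (J : Ideal R),
    J ≤ Module.annihilator R M → (∀ r ∈ xs, r ∈ maximalIdeal R) →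
    maximalIdeal R ≤ (J ⊔ Ideal.ofList xs).radical →
    (∃ rs : List R, rs.length = xs.length ∧ (∀ r ∈ rs, r ∈ maximalIdeal R) ∧ IsRegular M rs) →
    IsRegular M xs := by
  induction xs with
  | nil =>
    rintro M _ _ _ J - - - ⟨rs, -, -, hrs⟩
    have := hrs.nontrivial
    exact IsRegular.nil R M
  | cons x xs ih =>
    rintro M _ _ _ J hJ hmem hrad ⟨rs, hlen, hrs, hreg⟩
    have := hreg.nontrivial
    simp only [List.mem_cons, forall_eq_or_imp] at hmem
    -- Otherwise `x` lies in an associated prime `p`, which also contains `J`. Then `xs` alone is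
    -- 𝔪-primary modulo `p`, so dim R/p ≤ |xs|, while the regular sequence `rs` forces dim R/p ≥
    -- |xs| + 1.
    have hx : IsSMulRegular M x := by
      by_contra hx
      have hx' : x ∈ ⋃ p ∈ associatedPrimes R M, (p : Set R) := by
        rw [biUnion_associatedPrimes_eq_compl_regular]
        exact hx
      simp only [Set.mem_iUnion, exists_prop] at hx'
      obtain ⟨p, hp, hxp⟩ := hx'
      have : p.IsPrime := IsAssociatedPrime.isPrime hp
      have hle : maximalIdeal R ≤ (p ⊔ Ideal.ofList xs).radical := by
        refine hrad.trans (Ideal.radical_mono ?_)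
        rw [Ideal.ofList_cons, ← sup_assoc]
        gcongr
        exact sup_le (hJ.trans (Submodule.annihilator_top (R := R) (M := M) ▸
          IsAssociatedPrime.annihilator_le hp))
          ((Ideal.span_singleton_le_iff_mem _).mpr hxp)
      have := (length_le_ringKrullDim_quotient rs hrs hreg.toIsWeaklyRegular hp).trans
        (ringKrullDim_quotient_le_length hle hmem.2)
      rw [hlen] at this
      have : xs.length + 1 ≤ xs.length := by exact_mod_cast this
      omega
    rw [isRegular_cons_iff]
    -- `J` collects the elements already divided out; this is why the induction carries it.
    refine ⟨hx, ih (J ⊔ Ideal.span {x}) ?_ hmem.2 ?_ ?_⟩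
    · refine sup_le (hJ.trans (LinearMap.annihilator_le_of_surjective _
        (Submodule.mkQ_surjective _))) ?_
      rw [Ideal.span_singleton_le_iff_mem, Module.mem_annihilator]
      intro m
      obtain ⟨m, rfl⟩ := Submodule.mkQ_surjective _ m
      rw [← map_smul, Submodule.mkQ_apply, Submodule.Quotient.mk_eq_zero]
      exact Submodule.smul_mem_pointwise_smul _ _ _ trivial
    · rwa [Ideal.ofList_cons, ← sup_assoc] at hrad
    · exact exists_isRegular_quotSMulTop ⟨rs, hlen, hrs, hreg⟩ hmem.1 hx

/-! ### Nakayama along a regular sequence. -/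

/-- A surjection `f : F → N` is injective if `ker f ⊆ (xs) F` for an `N`-regular sequence `xs` in
the maximal ideal. -/
lemma ker_eq_bot_of_ker_le_ofList_smul [IsNoetherianRing R] (xs : List R) :
    ∀ {F N : Type u} [AddCommGroup F] [Module R F] [Module.Finite R F] [AddCommGroup N]
    [Module R N] (f : F →ₗ[R] N), Function.Surjective f → (∀ r ∈ xs, r ∈ maximalIdeal R) →
    IsWeaklyRegular N xs → LinearMap.ker f ≤ Ideal.ofList xs • ⊤ → LinearMap.ker f = ⊥ := by
  induction xs with
  | nil =>
    intro F N _ _ _ _ _ f _ _ _ h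
    simpa using h
  | cons x xs ih =>
    intro F N _ _ _ _ _ f hf hmem hreg hker
    rw [isWeaklyRegular_cons_iff] at hreg
    simp only [List.mem_cons, forall_eq_or_imp] at hmem
    -- Surjectivity of `f` suffices here: if `f y = x w`, lift `w` to `v` and replace `y` by `y - x
    -- v`.
    have hmap : LinearMap.ker (QuotSMulTop.map x f) =
        (LinearMap.ker f).map (x • (⊤ : Submodule R F)).mkQ := by
      apply le_antisymm
      · intro z hz
        obtain ⟨y, rfl⟩ := Submodule.mkQ_surjective _ z
        rw [LinearMap.mem_ker, Submodule.mkQ_apply, QuotSMulTop.map_apply_mk,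
          Submodule.Quotient.mk_eq_zero] at hz
        obtain ⟨w, -, hw⟩ := (Submodule.mem_smul_pointwise_iff_exists _ _ _).mp hz
        obtain ⟨v, rfl⟩ := hf w
        refine ⟨y - x • v, by simp [hw], ?_⟩
        rw [map_sub, sub_eq_self, Submodule.mkQ_apply, Submodule.Quotient.mk_eq_zero]
        exact Submodule.smul_mem_pointwise_smul _ _ _ trivial
      · rw [Submodule.map_le_iff_le_comap]
        intro y hy
        rw [Submodule.mem_comap, LinearMap.mem_ker, Submodule.mkQ_apply, QuotSMulTop.map_apply_mk,
          LinearMap.mem_ker.mp hy, Submodule.Quotient.mk_zero]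
    have key := ih (QuotSMulTop.map x f) (QuotSMulTop.map_surjective x hf) hmem.2 hreg.2 (by
      rw [hmap]
      refine (Submodule.map_mono hker).trans ?_
      rw [Ideal.ofList_cons, Submodule.sup_smul, Submodule.map_sup,
        Submodule.ideal_span_singleton_smul, Submodule.map_smul'', Submodule.map_top,
        Submodule.range_mkQ, sup_le_iff]
      refine ⟨?_, le_rfl⟩
      rw [(LinearMap.le_ker_iff_map (f := (x • (⊤ : Submodule R F)).mkQ)).mp
        (Submodule.ker_mkQ _).ge]
      exact bot_le)
    rw [hmap] at key
    have hle : LinearMap.ker f ≤ x • (⊤ : Submodule R F) := by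
      rw [← Submodule.ker_mkQ (x • (⊤ : Submodule R F)), LinearMap.le_ker_iff_map, key]
    -- From `ker f ⊆ xF` and regularity of `x` on `N` follows `ker f = x ker f`.
    refine Submodule.eq_bot_of_le_smul_of_le_jacobson_bot (maximalIdeal R) _
      (IsNoetherian.noetherian _) ?_ (maximalIdeal_le_jacobson _)
    intro y hy
    obtain ⟨w, -, rfl⟩ := (Submodule.mem_smul_pointwise_iff_exists _ _ _).mp (hle hy)
    rw [LinearMap.mem_ker, map_smul] at hy
    exact Submodule.smul_mem_smul hmem.1 (hreg.1.right_eq_zero_of_smul hy)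

end IsLocalRing

/-! ### Minimal generators and relations under base change. -/

/-- A finite module over a local ring has a finite family of generators such that the coefficients
of all relations lie in the maximal ideal. -/
lemma exists_minimal_generators [IsLocalRing R] (M : Type u) [AddCommGroup M] [Module R M]
    [Module.Finite R M] :
    ∃ (r : ℕ) (v : Fin r → M), Submodule.span R (Set.range v) = ⊤ ∧
      ∀ a : Fin r → R, ∑ i, a i • v i = 0 → ∀ i, a i ∈ maximalIdeal R := by
  let b := Module.finBasis (ResidueField R) (ResidueField R ⊗[R] M)
  have hsurj : Function.Surjective (TensorProduct.mk R (ResidueField R) M 1) :=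
    TensorProduct.mk_surjective R M (ResidueField R) residue_surjective
  choose v hv using fun i ↦ hsurj (b i)
  refine ⟨_, v, IsLocalRing.span_eq_top_of_tmul_eq_basis v b hv, fun a ha i ↦ ?_⟩
  have h : ∑ i, residue R (a i) • b i = 0 := by
    have := congrArg (TensorProduct.mk R (ResidueField R) M 1) ha
    rw [map_sum, map_zero] at this
    rw [← this]
    refine Finset.sum_congr rfl fun i _ ↦ ?_
    rw [map_smul, hv]
    rfl
  rw [← residue_eq_zero_iff]
  exact Fintype.linearIndependent_iff.mp b.linearIndependent _ h i

section ExtendScalars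

variable (φ : R →+* R) {M : Type u} [AddCommGroup M] [Module R M] {r : ℕ} {v : Fin r → M}

/-- The canonical semilinear map `m ↦ 1 ⊗ m` from `M` to its base change along `φ`. -/
noncomputable def toExtendScalars (M : Type u) [AddCommGroup M] [Module R M] :
    M →ₛₗ[φ] (ModuleCat.extendScalars φ).obj (ModuleCat.of R M) where
  toFun m := (ModuleCat.extendRestrictScalarsAdj φ).unit.app (ModuleCat.of R M) m
  map_add' a b := map_add _ _ _
  map_smul' c m := by
    rw [map_smul]
    rfl

lemma span_range_toExtendScalars (hv : Submodule.span R (Set.range v) = ⊤) :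
    Submodule.span R (Set.range fun i ↦ toExtendScalars φ M (v i)) = ⊤ := by
  have hmem (m : M) : toExtendScalars φ M m ∈
      Submodule.span R (Set.range fun i ↦ toExtendScalars φ M (v i)) := by
    have hm : m ∈ Submodule.span R (Set.range v) := hv ▸ trivial
    induction hm using Submodule.span_induction with
    | mem x hx =>
      obtain ⟨i, rfl⟩ := hx
      exact Submodule.subset_span ⟨i, rfl⟩
    | zero => rw [map_zero]; exact Submodule.zero_mem _
    | add x y _ _ hx hy => rw [map_add]; exact Submodule.add_mem _ hx hy
    | smul a x _ hx => rw [map_smulₛₗ]; exact Submodule.smul_mem _ _ hx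
  refine (Submodule.eq_top_iff').mpr fun z ↦ ?_
  induction z using TensorProduct.induction_on with
  | zero => exact Submodule.zero_mem _
  | tmul s m =>
    have h := ModuleCat.ExtendScalars.smul_tmul φ (M := ModuleCat.of R M) s (1 : R) m
    erw [mul_one] at h
    have h' := Submodule.smul_mem _ (show R from s) (hmem m)
    exact h ▸ h'
  | add x y hx hy => exact Submodule.add_mem _ hx hy

/-- By `hI`, sending ∑ aᵢvᵢ to the classes of φ(aᵢ) is a well-defined semilinear map M → (R/I)^r.
Its adjoint is linear on the base change and takes 1 ⊗ vᵢ to the i-th unit vector, so it reads off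
each sᵢ modulo I. -/
lemma mem_of_sum_smul_toExtendScalars_eq_zero (hv : Submodule.span R (Set.range v) = ⊤)
    {I : Ideal R} (hI : ∀ a : Fin r → R, ∑ i, a i • v i = 0 → ∀ i, φ (a i) ∈ I)
    (s : Fin r → R) (hs : ∑ i, s i • toExtendScalars φ M (v i) = 0) (i : Fin r) : s i ∈ I := by
  classical
  let π : (Fin r → R) →ₗ[R] M := Fintype.linearCombination R v
  have hπ : Function.Surjective π := by
    rw [← LinearMap.range_eq_top, Fintype.range_linearCombination, hv]
  let h : (Fin r → R) →ₛₗ[φ] (Fin r → R ⧸ I) :=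
    { toFun a i := Ideal.Quotient.mk I (φ (a i))
      map_add' a b := by ext; simp
      map_smul' c a := by ext; simp [Algebra.smul_def] }
  have hker : LinearMap.ker π ≤ LinearMap.ker h := by
    intro a ha
    ext i
    exact Ideal.Quotient.eq_zero_iff_mem.mpr (hI a ha i)
  let g : M →ₛₗ[φ] (Fin r → R ⧸ I) :=
    ((LinearMap.ker π).liftQ h hker).comp (π.quotKerEquivOfSurjective hπ).symm.toLinearMap
  have hg (i : Fin r) : g (v i) = Pi.single i 1 := by
    have : (π.quotKerEquivOfSurjective hπ).symm (v i) = Submodule.Quotient.mk (Pi.single i 1) := by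
      rw [LinearEquiv.symm_apply_eq]
      simp [π, LinearMap.quotKerEquivOfSurjective_apply_mk, Fintype.linearCombination_apply_single]
    change (LinearMap.ker π).liftQ h hker ((π.quotKerEquivOfSurjective hπ).symm (v i)) = _
    rw [this, Submodule.liftQ_apply]
    ext j
    by_cases hij : j = i
    · subst hij; simp [h]
    · simp [h, hij]
  let g' := ((ModuleCat.extendRestrictScalarsAdj φ).homEquiv (ModuleCat.of R M)
    (ModuleCat.of R (Fin r → R ⧸ I))).symm (ModuleCat.semilinearMapAddEquiv φ _ _ g)
  have hg' (m : M) : g' (toExtendScalars φ M m) = g m := by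
    have := ConcreteCategory.congr_hom
      (((ModuleCat.extendRestrictScalarsAdj φ).homEquiv (ModuleCat.of R M)
        (ModuleCat.of R (Fin r → R ⧸ I))).apply_symm_apply
          (ModuleCat.semilinearMapAddEquiv φ _ _ g)) m
    rw [ModuleCat.extendRestrictScalarsAdj_homEquiv_apply] at this
    exact this
  have := congrArg g' hs
  rw [map_sum, map_zero] at this
  simp only [map_smul, hg', hg] at this
  have := congrFun this i
  simp only [Finset.sum_apply, Pi.smul_apply, Pi.single_apply] at this
  simp only [smul_ite, smul_zero, Finset.sum_ite_eq, Finset.mem_univ, if_true] at this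
  rw [← Ideal.Quotient.eq_zero_iff_mem, ← mul_one (Ideal.Quotient.mk I (s i))]
  exact this

end ExtendScalars

/-! ### Nilpotent relations and freeness. -/

/-- Let `M` have projective localization at the nonzerodivisors. If `M` has generators such
that the coefficients of all relations are nilpotent, then these are linearly independent. -/
lemma linearIndependent_of_isNilpotent [IsNoetherianRing R] {M : Type u} [AddCommGroup M]
    [Module R M]
    [Module.Projective (Localization (nonZeroDivisors R)) (LocalizedModule (nonZeroDivisors R) M)]
    {r : ℕ} {v : Fin r → M} (hv : Submodule.span R (Set.range v) = ⊤)
    (hnil : ∀ a : Fin r → R, ∑ i, a i • v i = 0 → ∀ i, IsNilpotent (a i)) :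
    LinearIndependent R v := by
  set S := nonZeroDivisors R
  let π : (Fin r → R) →ₗ[R] M := Fintype.linearCombination R v
  have hπ : Function.Surjective π := by
    rw [← LinearMap.range_eq_top, Fintype.range_linearCombination, hv]
  let πS := LocalizedModule.map S π
  have hπS : Function.Surjective πS := LocalizedModule.map_surjective S π hπ
  obtain ⟨σ, hσ⟩ := Module.projective_lifting_property πS LinearMap.id hπS
  -- Clearing denominators turns an element of the kernel into a relation over `R`, whose
  -- coefficients are nilpotent.
  have hle : LinearMap.ker πS ≤ nilradical (Localization S) • ⊤ := by
    classical
    intro y hy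
    induction y using LocalizedModule.induction_on with
    | _ a s =>
    rw [LinearMap.mem_ker, LocalizedModule.map_mk, ← LocalizedModule.zero_mk s,
      LocalizedModule.mk_eq] at hy
    obtain ⟨u, hu⟩ := hy
    have hu' : π ((u * s) • a) = 0 := by
      rw [Submonoid.smul_def, map_smul, ← Submonoid.smul_def, mul_smul, hu, smul_zero, smul_zero]
    have hy : LocalizedModule.mk a s = Localization.mk 1 ((u * s) * s) •
        LocalizedModule.mkLinearMap S (Fin r → R) ((u * s) • a) := by
      rw [LocalizedModule.mkLinearMap_apply, LocalizedModule.mk_smul_mk, LocalizedModule.mk_eq]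
      exact ⟨1, by simp only [one_smul, mul_one, mul_smul]; simp only [smul_comm s u]⟩
    rw [hy]
    refine Submodule.smul_mem _ _ ?_
    rw [pi_eq_sum_univ' ((u * s) • a), map_sum]
    refine Submodule.sum_mem _ fun i _ ↦ ?_
    rw [map_smul, ← algebraMap_smul (Localization S) (M := LocalizedModule S (Fin r → R))]
    exact Submodule.smul_mem_smul
      (mem_nilradical.mpr ((hnil _ hu' i).map (algebraMap R (Localization S)))) trivial
  have hbot : LinearMap.ker πS = ⊥ := by
    -- `e` projects onto `ker πS`, so applying it to `hle` gives `ker πS ⊆ nil · ker πS`.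
    let e : LocalizedModule S (Fin r → R) →ₗ[Localization S] LocalizedModule S (Fin r → R) :=
      LinearMap.id - σ ∘ₗ πS
    have he : LinearMap.range e ≤ LinearMap.ker πS := by
      rintro _ ⟨y, rfl⟩
      have := LinearMap.congr_fun hσ (πS y)
      simp only [LinearMap.comp_apply, LinearMap.id_apply] at this
      simp [e, this]
    have := IsLocalization.isNoetherianRing S (Localization S) inferInstance
    refine Submodule.eq_bot_of_le_smul_of_le_jacobson_bot (nilradical (Localization S)) _
      (IsNoetherian.noetherian _) ?_ (Ideal.radical_le_jacobson)
    intro y hy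
    have hey : e y = y := by
      simp [e, LinearMap.mem_ker.mp hy]
    rw [← hey]
    have := Submodule.mem_map_of_mem (f := e) (hle hy)
    rw [Submodule.map_smul'', Submodule.map_top] at this
    exact Submodule.smul_mono le_rfl he this
  rw [Fintype.linearIndependent_iff]
  intro a ha i
  have h1 : LocalizedModule.mk a (1 : S) ∈ LinearMap.ker πS := by
    rw [LinearMap.mem_ker, LocalizedModule.map_mk, show π a = 0 from ha, LocalizedModule.zero_mk]
  rw [hbot, Submodule.mem_bot, ← LocalizedModule.zero_mk 1, LocalizedModule.mk_eq] at h1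
  obtain ⟨u, hu⟩ := h1
  simp only [one_smul, smul_zero] at hu
  exact (mem_nonZeroDivisors_iff.mp u.2).1 _ (congrFun hu i)

/-! ### MCM modules, κ(R) and the conclusion. -/

/-- A finite nonzero module of depth at least `n` has a regular sequence of length `n`. -/
lemma exists_isRegular_of_le_depth [IsLocalRing R] {M : Type u} [AddCommGroup M] [Module R M]
    [Module.Finite R M] [Nontrivial M] {n : ℕ} (h : (n : ℕ∞) ≤ depth R M) :
    ∃ rs : List R, rs.length = n ∧ (∀ r ∈ rs, r ∈ maximalIdeal R) ∧ IsRegular M rs := by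
  cases n with
  | zero => exact ⟨[], rfl, by simp, IsRegular.nil R M⟩
  | succ n =>
    -- Only a strict bound below a supremum yields a member: a regular sequence longer than `n`,
    -- then truncated to length `n + 1`.
    have hlt : (n : ℕ∞) < depth R M := lt_of_lt_of_le (by exact_mod_cast n.lt_succ_self) h
    simp only [depth, lt_iSup_iff, Set.mem_ofPred_eq, exists_prop] at hlt
    obtain ⟨rs, ⟨hmem, hreg⟩, hlen⟩ := hlt
    have hmem' : ∀ r ∈ rs.take (n + 1), r ∈ maximalIdeal R :=
      fun r hr ↦ hmem r (List.mem_of_mem_take hr)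
    refine ⟨rs.take (n + 1), ?_, hmem', ?_⟩
    · rw [List.length_take, min_eq_left]
      exact_mod_cast hlen
    · refine IsRegular.of_isWeaklyRegular_of_mem_maximalIdeal M hmem' ?_
      have := hreg.toIsWeaklyRegular
      rw [← List.take_append_drop (n + 1) rs, isWeaklyRegular_append_iff] at this
      exact this.1

lemma ofList_ofFn {d : ℕ} (x : Fin d → R) :
    Ideal.ofList (List.ofFn x) = Ideal.span (Set.range x) := by
  simp [Ideal.ofList, List.mem_ofFn, Set.range]

/-- Every system of parameters is a regular sequence on a maximal Cohen-Macaulay module. -/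
lemma IsSystemOfParameters.isRegular [IsLocalRing R] [IsNoetherianRing R] {d : ℕ} {x : Fin d → R}
    (hx : IsSystemOfParameters R x) {M : Type u} [AddCommGroup M] [Module R M]
    (hM : IsMaximalCohenMacaulay R M) : IsRegular M (List.ofFn x) := by
  have := hM.finite
  have := hM.nontrivial
  refine isRegular_of_maximalIdeal_le_radical _ ⊥ bot_le ?_ ?_ ?_
  · intro r hr
    rw [List.mem_ofFn] at hr
    exact hx.2 ▸ Ideal.le_radical (Ideal.subset_span hr)
  · rw [bot_sup_eq, ofList_ofFn, hx.2]
  · rw [List.length_ofFn]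
    refine exists_isRegular_of_le_depth ?_
    have := hx.1.trans hM.depth_eq.symm
    exact le_of_eq (by exact_mod_cast this)

/-- For `κ(R) ≤ n`, the Frobenius power `𝔪^[p^n]` is contained in a parameter ideal. -/
lemma exists_isSystemOfParameters_of_kappa_le [IsLocalRing R] {p n : ℕ} [Fact p.Prime]
    (hn : kappa R p ≤ (n : ℕ∞)) :
    ∃ (d : ℕ) (x : Fin d → R), IsSystemOfParameters R x ∧
      ∀ a ∈ maximalIdeal R, a ^ p ^ n ∈ Ideal.span (Set.range x) := by
  -- Strictness makes some `t < n + 1` occur in the infimum; its powers are then raised to the `p ^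
  -- (n - t)`.
  have hlt : kappa R p < ((n + 1 : ℕ) : ℕ∞) := lt_of_le_of_lt hn (by exact_mod_cast n.lt_succ_self)
  simp only [kappa, iInf_lt_iff, Set.mem_ofPred_eq, exists_prop] at hlt
  obtain ⟨t, ⟨d, x, hx, hle⟩, htn⟩ := hlt
  have htn : t ≤ n := Nat.lt_succ_iff.mp (by exact_mod_cast htn)
  refine ⟨d, x, hx, fun a ha ↦ ?_⟩
  have hat : a ^ p ^ t ∈ Ideal.span (Set.range x) := hle (Ideal.subset_span ⟨a, ha, rfl⟩)
  obtain ⟨k, rfl⟩ := Nat.exists_eq_add_of_le htn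
  rw [pow_add, pow_mul]
  exact Ideal.pow_mem_of_mem _ hat _ (pow_pos (Fact.out : p.Prime).pos k)

/-- A finite free nonzero module of finite injective dimension has the ring as a direct summand. -/
lemma HasFiniteInjectiveDimension.of_basis {M : Type u} [AddCommGroup M] [Module R M]
    [Nontrivial M] {ι : Type*} (b : Module.Basis ι R M) (hM : HasFiniteInjectiveDimension R M) :
    HasFiniteInjectiveDimension R R := by
  obtain ⟨n, hn⟩ := hM
  obtain ⟨i⟩ := b.index_nonempty
  let e : Retract (ModuleCat.of R R) (ModuleCat.of R M) :=
    { i := ModuleCat.ofHom (LinearMap.toSpanSingleton R M (b i))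
      r := ModuleCat.ofHom (b.coord i)
      retract := by
        ext
        simp }
  exact ⟨n, e.hasInjectiveDimensionLT (n + 1)⟩

/-- If the base change of `M` along an endomorphism `φ` with `φ(𝔪) ⊆ (x)` is maximal
Cohen-Macaulay, for a system of parameters `x`, then `φ` kills the coefficients of all relations
between minimal generators of `M`. -/
lemma map_eq_zero_of_isMaximalCohenMacaulay_extendScalars [IsLocalRing R] [IsNoetherianRing R]
    (φ : R →+* R) {d : ℕ} {x : Fin d → R} (hx : IsSystemOfParameters R x)
    (hφ : ∀ a ∈ maximalIdeal R, φ a ∈ Ideal.span (Set.range x))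
    {M : Type u} [AddCommGroup M] [Module R M] {r : ℕ} {v : Fin r → M}
    (hv : Submodule.span R (Set.range v) = ⊤)
    (hmin : ∀ a : Fin r → R, ∑ i, a i • v i = 0 → ∀ i, a i ∈ maximalIdeal R)
    (hM : IsMaximalCohenMacaulay R ((ModuleCat.extendScalars φ).obj (ModuleCat.of R M)))
    (a : Fin r → R) (ha : ∑ i, a i • v i = 0) (i : Fin r) : φ (a i) = 0 := by
  let f : (Fin r → R) →ₗ[R] (ModuleCat.extendScalars φ).obj (ModuleCat.of R M) :=
    Fintype.linearCombination R fun i ↦ toExtendScalars φ M (v i)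
  have hf : Function.Surjective f := by
    rw [← LinearMap.range_eq_top, Fintype.range_linearCombination,
      span_range_toExtendScalars φ hv]
  have hker : LinearMap.ker f ≤ Ideal.ofList (List.ofFn x) • ⊤ := by
    intro s hs
    rw [pi_eq_sum_univ' s]
    refine Submodule.sum_mem _ fun j _ ↦ Submodule.smul_mem_smul ?_ trivial
    rw [ofList_ofFn]
    exact mem_of_sum_smul_toExtendScalars_eq_zero φ hv (fun b hb k ↦ hφ _ (hmin b hb k)) s hs j
  have hbot := ker_eq_bot_of_ker_le_ofList_smul _ f hf (fun r hr ↦ by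
    rw [List.mem_ofFn] at hr
    exact hx.2 ▸ Ideal.le_radical (Ideal.subset_span hr)) (hx.isRegular hM).toIsWeaklyRegular hker
  -- The semilinear map m ↦ 1 ⊗ m carries the relation `a` to the relation φ(a), which `hbot` makes
  -- trivial.
  have hmem : (fun j ↦ φ (a j)) ∈ LinearMap.ker f := by
    have := congrArg (toExtendScalars φ M) ha
    rw [map_sum, map_zero] at this
    rw [LinearMap.mem_ker, ← this, Fintype.linearCombination_apply]
    exact Finset.sum_congr rfl fun j _ ↦ ((toExtendScalars φ M).map_smulₛₗ (a j) (v j)).symm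
  rw [hbot] at hmem
  exact congrFun hmem i

end FrobeniusGorenstein

theorem corollary2p6 (R : Type u) [CommRing R] [IsLocalRing R]
    (p : ℕ) [Fact p.Prime] [CharP R p]
    (hR : FrobeniusGorenstein.IsCohenMacaulayLocalRing R)
    (ω : Type u) [AddCommGroup ω] [Module R ω]
    (hω : FrobeniusGorenstein.IsCanonicalModule R ω)
    (hrank : FrobeniusGorenstein.HasRank R ω)
    (n : ℕ) (hn : FrobeniusGorenstein.kappa R p ≤ (n : ℕ∞))
    (hF : FrobeniusGorenstein.IsMaximalCohenMacaulay R
      ((FrobeniusGorenstein.frobeniusFunctor R p n).obj (ModuleCat.of R ω))) :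
    FrobeniusGorenstein.IsGorensteinLocalRing R := by
  have := hR.noetherian
  have := hω.maximalCohenMacaulay.finite
  have := hω.maximalCohenMacaulay.nontrivial
  obtain ⟨_, ⟨e⟩⟩ := hrank
  have := Module.Projective.of_equiv e.symm
  obtain ⟨d, x, hx, hmx⟩ := FrobeniusGorenstein.exists_isSystemOfParameters_of_kappa_le hn
  obtain ⟨r, v, hv, hmin⟩ := FrobeniusGorenstein.exists_minimal_generators (R := R) ω
  have hli : LinearIndependent R v :=
    -- For the iterated Frobenius, φ(aᵢ) = 0 says aᵢ^(p^n) = 0, hence the exponent.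
    FrobeniusGorenstein.linearIndependent_of_isNilpotent hv fun a ha i ↦ ⟨p ^ n,
      FrobeniusGorenstein.map_eq_zero_of_isMaximalCohenMacaulay_extendScalars
        (iterateFrobenius R p n) hx hmx hv hmin hF a ha i⟩
  exact ⟨hR.noetherian, hω.finite_injectiveDimension.of_basis (Module.Basis.mk hli hv.ge)⟩
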